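/- Let $\mathbf M$ be an $r\times r$ transition matrix (a transition $a\to b$ is allowed when $\mathbf M(a,b)=1$), let $\Sigma=\{\mathbf x\in\{1,\dots,r\}^{\mathbb N}:\mathbf M(x_j,x_{j+1})=1\ \forall j\ge 0\}$ be the one-sided subshift of finite type with left shift $\sigma$, and let $\Sigma^*=\{\mathbf y\in\{1,\dots,r\}^{\mathbb N}:\mathbf M(y_{j+1},y_j)=1\ \forall j\ge 0\}$. Assume that $\sigma:\Sigma\to\Sigma$ is topologically transitive: for all non-empty open $D,E\subset\Sigma$ there is $k\ge 0$ with $\sigma^k(D)\cap E\neq\emptyset$. Fix $\lambda\in(0,1)$ and equip $\Sigma$ and $\Sigma^*$ with the metric $d(\mathbf x,\bar{\mathbf x})=\lambda^{\min\{j:\,x_j\neq\bar x_j\}}$ for $\mathbf x\ne\bar{\mathbf x}$. Let $\hat\Sigma=\{(\mathbf y,\mathbf x)\in\Sigma^*\times\Sigma:\mathbf M(y_0,x_0)=1\}$ carry the maximum metric, let $\pi_1(\mathbf y,\mathbf x)=\mathbf x$ and $\tau_{\mathbf y}(\mathbf x)=(y_0,x_0,x_1,\dots)$ for $(\mathbf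 y,\mathbf x)\in\hat\Sigma$. A Borel probability measure $\hat\mu$ on $\hat\Sigma$ is holonomic if $\int f(\tau_{\mathbf y}(\mathbf x))\,d\hat\mu(\mathbf y,\mathbf x)=\int f(\mathbf x)\,d\hat\mu(\mathbf y,\mathbf x)$ for all $f\in C^0(\Sigma)$; $\mathcal M_0$ is the set of these. For continuous $A:\hat\Sigma\to\mathbb R$ put $\beta_A=\max_{\hat\nu\in\mathcal M_0}\int A\,d\hat\nu$ and let $m_A$ be the set of $\hat\mu\in\mathcal M_0$ with $\int A\,d\hat\mu=\beta_A$. Let $\Omega(A)$ be the set of $\mathbf x\in\Sigma$ such that for every $\epsilon>0$ there are $k\ge 1$ and points $(\mathbf y^0,\mathbf x^0),\dots,(\mathbf y^{k-1},\mathbf x^{k-1})\in\hat\Sigma$ with $\mathbf x^0=\mathbf x$, $\mathbf x^{j+1}=\tau_{\mathbf y^j}(\mathbf x^j)$ for $0\le j<k-1$, $d(\tau_{\mathbf y^{k-1}}(\mathbf x^{k-1}),\mathbf x)<\epsilon$ and $\left|\sum_{j=0}^{k-1}(A(\mathbf y^j,\mathbf x^j)-\beta_A)\right|<\epsilon$.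 Let $\theta>0$, let $A:\hat\Sigma\to\mathbb R$ be $\theta$-Hölder, and let $\hat\mu\in m_A$ be such that the projected measure $\hat\mu\circ\pi_1^{-1}$ is ergodic for $\sigma$. Then $\pi_1(\operatorname{supp}\hat\mu)\subset\Omega(A)$. -/

import Mathlib

open MeasureTheory

noncomputable section

namespace Holonomic

variable {r : ℕ}

/-- The sequences over `r` symbols all of whose transitions are allowed by `M`, an `r × r`
transition matrix (a transition `a → b` is allowed when the entry `M a b` equals `1`).
As a subset of `ℕ → Fin r` it carries the product topology and its Borel sigma-algebra. -/
def shiftSpace (M : Matrix (Fin r) (Fin r) ℕ) : Set (ℕ → Fin r) :=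
  {x | ∀ j, M (x j) (x (j + 1)) = 1}

/-- The left shift on the one-sided subshift of finite type. -/
def shift {M : Matrix (Fin r) (Fin r) ℕ} (x : shiftSpace M) : shiftSpace M :=
  ⟨fun j => x.1 (j + 1), fun j => x.2 (j + 1)⟩

/-- Topological transitivity of the shift. -/
def IsTransitive (M : Matrix (Fin r) (Fin r) ℕ) : Prop :=
  ∀ U V : Set (shiftSpace M), IsOpen U → IsOpen V → U.Nonempty → V.Nonempty →
    ∃ k : ℕ, ((shift^[k] '' U) ∩ V).Nonempty

/-- The metric `lam ^ k`, where `k` is the first index at which the two sequences differ. -/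
def seqDist (lam : ℝ) (x y : ℕ → Fin r) : ℝ :=
  open Classical in if x = y then 0 else lam ^ PiNat.firstDiff x y

/-- The space of the natural extension: pairs `(y, x)`, with `y` in the dual subshift (given by the
transposed matrix) and `x` in the subshift, such that the word `y₀ x₀` is allowed. -/
def hatSpace (M : Matrix (Fin r) (Fin r) ℕ) :
    Set (shiftSpace M.transpose × shiftSpace M) :=
  {p | M (p.1.1 0) (p.2.1 0) = 1}

/-- The canonical projection `(y, x) ↦ x`. -/
def proj {M : Matrix (Fin r) (Fin r) ℕ} (p : hatSpace M) : shiftSpace M := p.1.2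

/-- The map `(y, x) ↦ (y₀, x₀, x₁, …)`. -/
def tau {M : Matrix (Fin r) (Fin r) ℕ} (p : hatSpace M) : shiftSpace M :=
  ⟨fun j => Nat.casesOn j (p.1.1.1 0) (fun i => p.1.2.1 i), fun j => by
    cases j with
    | zero => exact p.2
    | succ i => exact p.1.2.2 i⟩

/-- The product (maximum) metric on `hatSpace M`. -/
def hatDist {M : Matrix (Fin r) (Fin r) ℕ} (lam : ℝ) (p q : hatSpace M) : ℝ :=
  max (seqDist lam p.1.1.1 q.1.1.1) (seqDist lam p.1.2.1 q.1.2.1)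

/-- `θ`-Hölder functions on `hatSpace M`. -/
def IsHolder {M : Matrix (Fin r) (Fin r) ℕ} (lam θ : ℝ) (A : hatSpace M → ℝ) : Prop :=
  ∃ C : ℝ, ∀ p q : hatSpace M, |A p - A q| ≤ C * hatDist lam p q ^ θ

/-- The holonomic Borel probabilities. -/
def holonomic (M : Matrix (Fin r) (Fin r) ℕ) : Set (Measure (hatSpace M)) :=
  {μ | IsProbabilityMeasure μ ∧
    ∀ f : C(shiftSpace M, ℝ), ∫ p, f (tau p) ∂μ = ∫ p, f (proj p) ∂μ}

/-- The maximal value `β_A` of the integral of `A` over the holonomic probabilities. -/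
def beta {M : Matrix (Fin r) (Fin r) ℕ} (A : hatSpace M → ℝ) : ℝ :=
  sSup ((fun μ : Measure (hatSpace M) => ∫ p, A p ∂μ) '' holonomic M)

/-- The set of `A`-maximizing holonomic probabilities. -/
def maximizing {M : Matrix (Fin r) (Fin r) ℕ} (A : hatSpace M → ℝ) :
    Set (Measure (hatSpace M)) :=
  {μ | μ ∈ holonomic M ∧ ∫ p, A p ∂μ = beta A}

/-- The paths `(y⁰, x⁰), …, (yⁿ, xⁿ)` with `n + 1` points that begin within `ε` of `x` and end
at `x'`: `x⁰ = x'`, `xʲ⁺¹ = τ(yʲ, xʲ)`, and `τ(yⁿ, xⁿ)` is at distance less than `ε` from `x`. -/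
def paths {M : Matrix (Fin r) (Fin r) ℕ} (lam : ℝ) (x x' : shiftSpace M) (ε : ℝ) (n : ℕ) :
    Set (Fin (n + 1) → hatSpace M) :=
  {p | proj (p 0) = x' ∧ (∀ j : Fin n, proj (p j.succ) = tau (p j.castSucc)) ∧
    seqDist lam (tau (p (Fin.last n))).1 x.1 < ε}

/-- The set `Ω(A)` of non-wandering points with respect to `A`. -/
def nonwandering {M : Matrix (Fin r) (Fin r) ℕ} (lam : ℝ) (A : hatSpace M → ℝ) :
    Set (shiftSpace M) :=
  {x | ∀ ε : ℝ, 0 < ε → ∃ n : ℕ, ∃ p ∈ paths lam x x ε n, |∑ j, (A (p j) - beta A)| < ε}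

end Holonomic

end

/-! Let `F x` be the maximum of `A` over the fibre of `tau` above `x`, and let ν be the projection
of `μ`. Since `A ≤ F ∘ tau`, holonomy gives `β_A ≤ ∫ F dν`. Conversely, a nearly optimal measurable
section of `tau` pushes ν to a holonomic measure, so `∫ F dν = β_A` (`integral_fiberMax_eq_beta`).
Thus `F - β_A` is a centred observable of an ergodic system.

Atkinson's theorem then gives, in every cylinder around a point `x` of the projected support, an
orbit segment that returns to the cylinder with small Birkhoff sum. Read backwards, with the tail
after the return replaced by `x` itself, the segment is a path from `x` to near `x`. Taking pasts
that maximize `A` along the original orbit, the Hölder condition makes the errors geometric, hence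
small uniformly in the length (`exists_path_of_near_return`). -/

open Filter Topology

/-! ### Ergodic theory: mean ergodic theorem and Atkinson recurrence. -/

/-- The Birkhoff sums of a centred square-integrable observable of an ergodic map are `o(n)` in
`L¹`: a consequence of von Neumann's mean ergodic theorem. -/
theorem Ergodic.tendsto_integral_abs_birkhoffSum_div {X : Type*} [MeasurableSpace X]
    {μ : Measure X} [IsProbabilityMeasure μ] {T : X → X} (hT : Ergodic T μ) {g : X → ℝ}
    (hg : MemLp g 2 μ) (hg0 : ∫ x, g x ∂μ = 0) :
    Tendsto (fun n : ℕ => (∫ x, |birkhoffSum T g n x| ∂μ) / n) atTop (𝓝 0) := by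
  have hTm := hT.toMeasurePreserving
  set U : Lp ℝ 2 μ →ₗᵢ[ℝ] Lp ℝ 2 μ := Lp.compMeasurePreservingₗᵢ ℝ T hTm with hU
  have hUval : ∀ f : Lp ℝ 2 μ, U f = Lp.compMeasurePreserving T hTm f := fun f => rfl
  have hiter : ∀ n, MemLp (g ∘ T^[n]) 2 μ := fun n => hg.comp_measurePreserving (hTm.iterate n)
  have hsum : ∀ n, MemLp (birkhoffSum T g n) 2 μ := fun n => by
    have : birkhoffSum T g n = fun x => ∑ k ∈ Finset.range n, (g ∘ T^[k]) x := rfl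
    rw [this]
    exact memLp_finsetSum _ fun k _ => hiter k
  have hUiter : ∀ n, U^[n] (hg.toLp g) = (hiter n).toLp _ := fun n => by
    induction n with
    | zero => rfl
    | succ n ih =>
      rw [Function.iterate_succ_apply', ih, hUval, Lp.toLp_compMeasurePreserving]
      rfl
  have hUsum : ∀ n, birkhoffSum U id n (hg.toLp g) = (hsum n).toLp _ := fun n => by
    induction n with
    | zero =>
      have : birkhoffSum T g 0 = 0 := by ext; simp [birkhoffSum]
      simp [this]
    | succ n ih =>
      rw [birkhoffSum_succ, ih, id, hUiter, ← MemLp.toLp_add]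
      congr 1
      ext x
      exact (birkhoffSum_succ T g n x).symm
  have hlim := U.toContinuousLinearMap.tendsto_birkhoffAverage_orthogonalProjection
    U.norm_toContinuousLinearMap_le (hg.toLp g)
  set S := (U.toContinuousLinearMap.toLinearMap).eqLocus
    (1 : Lp ℝ 2 μ →L[ℝ] Lp ℝ 2 μ).toLinearMap with hS
  -- The projection `P` of `g` to the invariant functions is a.e. a constant `c` by ergodicity, so
  -- `‖P‖² = ⟨P, g⟩ = c ∫ g = 0`.
  have hproj : ((S.orthogonalProjectionOnto (hg.toLp g) : S) : Lp ℝ 2 μ) = 0 := by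
    set P : Lp ℝ 2 μ := (S.orthogonalProjectionOnto (hg.toLp g) : S).1 with hP
    have hPS : U P = P := (S.orthogonalProjectionOnto (hg.toLp g)).2
    obtain ⟨c, hc⟩ := hT.ae_eq_const_of_ae_eq_comp_ae (Lp.aestronglyMeasurable P) (by
      have h1 := Lp.coeFn_compMeasurePreserving P hTm
      rw [← hUval, hPS] at h1
      exact h1.symm)
    have h1 : inner ℝ P (hg.toLp g - P) = 0 := by
      have := S.sub_starProjection_mem_orthogonal (hg.toLp g)
      exact this P (S.orthogonalProjectionOnto (hg.toLp g)).2
    rw [inner_sub_right, real_inner_self_eq_norm_sq] at h1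
    have h2 : inner ℝ P (hg.toLp g) = 0 := by
      rw [L2.inner_def]
      have : ∫ a, inner ℝ (P a) ((hg.toLp g) a) ∂μ = ∫ a, c * g a ∂μ := by
        refine integral_congr_ae ?_
        filter_upwards [hc, hg.coeFn_toLp] with a ha hb
        rw [ha, hb]
        simp [mul_comm]
      rw [this, integral_const_mul, hg0, mul_zero]
    rw [h2] at h1
    exact norm_eq_zero.1 (by nlinarith [norm_nonneg P])
  rw [hproj] at hlim
  have hlim' := hlim.norm
  rw [norm_zero] at hlim'
  refine squeeze_zero (fun n => by positivity) (fun n => ?_) hlim'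
  have e1 : ‖birkhoffAverage ℝ U id n (hg.toLp g)‖
      = (eLpNorm (birkhoffSum T g n) 2 μ).toReal / n := by
    rw [birkhoffAverage, hUsum, norm_smul, Lp.norm_toLp]
    simp [div_eq_inv_mul]
  refine le_of_le_of_eq ?_ e1.symm
  gcongr
  have e2 : ∫ x, |birkhoffSum T g n x| ∂μ = (eLpNorm (birkhoffSum T g n) 1 μ).toReal := by
    rw [eLpNorm_one_eq_lintegral_enorm, ← integral_norm_eq_lintegral_enorm (hsum n).1]
    rfl
  rw [e2]
  exact ENNReal.toReal_mono (hsum n).2.ne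
    (eLpNorm_le_eLpNorm_of_exponent_le (by norm_num) (hsum n).1)

/-- An `ε`-separated family of reals in `[-R, R]` has at most `2 R / ε + 1` members. -/
theorem card_le_of_separated {ι : Type*} (s : Finset ι) (f : ι → ℝ) {R ε : ℝ} (hR : 0 ≤ R)
    (hε : 0 < ε) (hf : ∀ i ∈ s, |f i| ≤ R)
    (hs : ∀ i ∈ s, ∀ j ∈ s, i ≠ j → ε ≤ |f i - f j|) : (s.card : ℝ) ≤ 2 * R / ε + 1 := by
  have h0 : ∀ i ∈ s, 0 ≤ (f i + R) / ε := fun i hi =>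
    div_nonneg (by linarith [(abs_le.1 (hf i hi)).1]) hε.le
  have hle : s.card ≤ (Finset.range (⌊2 * R / ε⌋₊ + 1)).card := by
    -- Cut the interval into cells of length `ε`: separated values lie in distinct cells.
    refine Finset.card_le_card_of_injOn (fun i => ⌊(f i + R) / ε⌋₊) (fun i hi => ?_)
      (fun i hi j hj hij => ?_)
    · simp only [Finset.coe_range, Set.mem_Iio, Nat.lt_succ_iff]
      refine Nat.floor_le_floor ?_
      gcongr
      linarith [(abs_le.1 (hf i hi)).2]
    · by_contra hne
      have h1 := hs i hi j hj hne
      have h2 : |(f i + R) / ε - (f j + R) / ε| < 1 := by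
        simp only at hij
        have a1 := Nat.floor_le (h0 i hi)
        have a2 := Nat.lt_floor_add_one ((f i + R) / ε)
        have b1 := Nat.floor_le (h0 j hj)
        have b2 := Nat.lt_floor_add_one ((f j + R) / ε)
        rw [hij] at a1 a2
        rw [abs_lt]
        constructor <;> linarith
      rw [← sub_div, abs_div, abs_of_pos hε, div_lt_one hε] at h2
      rw [add_sub_add_right_eq_sub] at h2
      linarith
  rw [Finset.card_range] at hle
  calc (s.card : ℝ) ≤ (⌊2 * R / ε⌋₊ : ℝ) + 1 := by exact_mod_cast hle
    _ ≤ _ := by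
      gcongr
      exact Nat.floor_le (by positivity)

/-- Atkinson's recurrence theorem: the Birkhoff sums of a centred observable of an ergodic map
are simultaneously recurrent with the orbits. -/
theorem Ergodic.exists_recurrent_abs_birkhoffSum_lt {X : Type*} [MeasurableSpace X]
    {μ : Measure X} [IsProbabilityMeasure μ] {T : X → X} (hT : Ergodic T μ) {g : X → ℝ}
    (hg : MemLp g 2 μ) (hg0 : ∫ x, g x ∂μ = 0) {B : Set X} (hB : MeasurableSet B)
    (hBpos : 0 < μ B) {ε : ℝ} (hε : 0 < ε) :
    ∃ z ∈ B, ∃ n : ℕ, T^[n + 1] z ∈ B ∧ |birkhoffSum T g (n + 1) z| < ε := by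
  by_contra! hcon
  have hTm := hT.toMeasurePreserving
  have hm : 0 < μ.real B := ENNReal.toReal_pos hBpos.ne' (measure_ne_top _ _)
  -- Visits to `B` with Birkhoff sum at most `R` in absolute value are few because these sums are
  -- `ε`-separated; each other visit is paid for by `|S| / R ≥ 1`.
  have hpt : ∀ R : ℝ, 0 < R → ∀ (N : ℕ) (z : X),
      ∑ n ∈ Finset.range N, B.indicator (fun _ => (1 : ℝ)) (T^[n + 1] z) ≤
        (2 * R / ε + 1) + ∑ n ∈ Finset.range N, |birkhoffSum T g (n + 1) z| / R := by
    classical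
    intro R hR N z
    set V := (Finset.range N).filter
      (fun n => T^[n + 1] z ∈ B ∧ |birkhoffSum T g (n + 1) z| ≤ R) with hV
    have hsep : ∀ i ∈ V, ∀ j ∈ V, i < j →
        ε ≤ |birkhoffSum T g (i + 1) z - birkhoffSum T g (j + 1) z| := by
      intro i hi j hj hij
      obtain ⟨k, rfl⟩ := Nat.exists_eq_add_of_lt hij
      simp only [hV, Finset.mem_filter] at hi hj
      have e : i + k + 1 + 1 = (i + 1) + (k + 1) := by ring
      -- The difference of the two sums is the Birkhoff sum of a return to `B` starting at `T^[i +
      -- 1] z`, so `z` itself need not lie in `B`.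
      have h1 := hcon _ hi.2.1 k (by
        rw [← Function.iterate_add_apply, add_comm (k + 1), ← e]
        exact hj.2.1)
      rw [e, birkhoffSum_add T g (i + 1), abs_sub_comm, add_sub_cancel_left]
      exact h1
    have hcard := card_le_of_separated V (fun n => birkhoffSum T g (n + 1) z) hR.le hε
      (fun i hi => (Finset.mem_filter.1 hi).2.2) (fun i hi j hj hij => by
        rcases lt_or_gt_of_ne hij with h | h
        · exact hsep i hi j hj h
        · rw [abs_sub_comm]
          exact hsep j hj i hi h)
    refine le_trans ?_ (add_le_add_left hcard _)
    rw [hV, Finset.card_filter, Nat.cast_sum, ← Finset.sum_add_distrib]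
    refine Finset.sum_le_sum fun n _ => ?_
    have hnn : 0 ≤ |birkhoffSum T g (n + 1) z| / R := by positivity
    by_cases h1 : T^[n + 1] z ∈ B
    · by_cases h2 : |birkhoffSum T g (n + 1) z| ≤ R
      · simpa [h1, h2, Set.indicator, -Function.iterate_succ] using hnn
      · have : 1 ≤ |birkhoffSum T g (n + 1) z| / R := by
          rw [one_le_div hR]
          exact (not_le.1 h2).le
        simpa [h1, h2, Set.indicator, -Function.iterate_succ] using this
    · simpa [h1, Set.indicator, -Function.iterate_succ] using hnn
  have hsum : ∀ n, MemLp (birkhoffSum T g n) 2 μ := fun n => by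
    have : birkhoffSum T g n = fun x => ∑ k ∈ Finset.range n, (g ∘ T^[k]) x := rfl
    rw [this]
    exact memLp_finsetSum _ fun k _ => hg.comp_measurePreserving (hTm.iterate k)
  have habs : ∀ n, Integrable (fun x => |birkhoffSum T g n x|) μ := fun n =>
    ((hsum n).integrable (by norm_num)).abs
  have hind : ∀ n, Integrable (fun z => B.indicator (fun _ => (1 : ℝ)) (T^[n] z)) μ := fun n =>
    (hTm.iterate n).integrable_comp_of_integrable ((integrable_const 1).indicator hB)
  have hindval : ∀ n, ∫ z, B.indicator (fun _ => (1 : ℝ)) (T^[n] z) ∂μ = μ.real B := fun n => by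
    have : (fun z => B.indicator (fun _ => (1 : ℝ)) (T^[n] z))
        = (T^[n] ⁻¹' B).indicator (fun _ => (1 : ℝ)) := rfl
    rw [this, integral_indicator_const _ ((hTm.iterate n).measurable hB), smul_eq_mul, mul_one,
      measureReal_def, measureReal_def, (hTm.iterate n).measure_preimage hB.nullMeasurableSet]
  have hint : ∀ R : ℝ, 0 < R → ∀ N : ℕ, N * μ.real B ≤
      (2 * R / ε + 1) + ∑ n ∈ Finset.range N, (∫ x, |birkhoffSum T g (n + 1) x| ∂μ) / R := by
    intro R hR N
    have h := integral_mono (integrable_finsetSum _ fun n _ => hind (n + 1))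
      ((integrable_const _).add (integrable_finsetSum _ fun n _ => (habs (n + 1)).div_const R))
      (hpt R hR N)
    simp only [Pi.add_apply] at h
    rw [integral_finsetSum _ fun n _ => hind (n + 1),
      integral_add (integrable_const _)
        (integrable_finsetSum _ fun n _ => (habs (n + 1)).div_const R),
      integral_finsetSum _ fun n _ => (habs (n + 1)).div_const R] at h
    simpa [hindval, integral_div, -Function.iterate_succ] using h
  set b : ℕ → ℝ := fun n => (∫ x, |birkhoffSum T g (n + 1) x| ∂μ) / ((n + 1 : ℕ) : ℝ) with hb
  have hb0 : Tendsto b atTop (𝓝 0) :=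
    (tendsto_add_atTop_iff_nat 1).2 (hT.tendsto_integral_abs_birkhoffSum_div hg hg0)
  have hces := hb0.cesaro
  -- With `R = δ N` the separated visits have asymptotic frequency at most `2δ/ε = μ(B)/2`, while
  -- the others contribute `o(1)`; this contradicts `μ(B) > 0`.
  set δ : ℝ := ε * μ.real B / 4 with hδ
  have hδpos : 0 < δ := by positivity
  have hmain : ∀ N : ℕ, 0 < N → μ.real B ≤
      2 * δ / ε + 1 / (N : ℝ) + δ⁻¹ * ((N : ℝ)⁻¹ * ∑ n ∈ Finset.range N, b n) := by
    intro N hN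
    have hN' : (0 : ℝ) < N := by exact_mod_cast hN
    have h := hint (δ * N) (by positivity) N
    have h2 : ∑ n ∈ Finset.range N, (∫ x, |birkhoffSum T g (n + 1) x| ∂μ) / (δ * N) ≤
        δ⁻¹ * ∑ n ∈ Finset.range N, b n := by
      rw [Finset.mul_sum]
      refine Finset.sum_le_sum fun n hn => ?_
      have hn1 : ((n + 1 : ℕ) : ℝ) ≤ N := by
        exact_mod_cast Finset.mem_range.1 hn
      rw [← div_div, inv_mul_eq_div, div_right_comm _ δ]
      have : 0 ≤ ∫ x, |birkhoffSum T g (n + 1) x| ∂μ := integral_nonneg fun _ => abs_nonneg _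
      gcongr
      exact div_le_div_of_nonneg_left this (by positivity) hn1
    have h3 : N * μ.real B ≤ 2 * (δ * N) / ε + 1 + δ⁻¹ * ∑ n ∈ Finset.range N, b n := by
      linarith
    calc μ.real B = (N * μ.real B) / N := by field_simp
      _ ≤ (2 * (δ * N) / ε + 1 + δ⁻¹ * ∑ n ∈ Finset.range N, b n) / N := by gcongr
      _ = _ := by field_simp
  have hlim : Tendsto (fun N : ℕ => 2 * δ / ε + 1 / (N : ℝ) +
      δ⁻¹ * ((N : ℝ)⁻¹ * ∑ n ∈ Finset.range N, b n)) atTop (𝓝 (2 * δ / ε + 0 + δ⁻¹ * 0)) :=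
    (tendsto_const_nhds.add tendsto_one_div_atTop_nhds_zero_nat).add (hces.const_mul _)
  have hfin := ge_of_tendsto hlim ((eventually_gt_atTop 0).mono hmain)
  have : 2 * δ / ε = μ.real B / 2 := by
    rw [hδ]
    field_simp
    norm_num
  rw [this] at hfin
  linarith

/-! ### Metric and topology of the shift spaces. -/

namespace Holonomic

variable {r : ℕ} {M : Matrix (Fin r) (Fin r) ℕ}

theorem seqDist_le_pow {lam : ℝ} (h0 : 0 < lam) (h1 : lam < 1) {x y : ℕ → Fin r} {n : ℕ}
    (h : ∀ i < n, x i = y i) : seqDist lam x y ≤ lam ^ n := by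
  unfold seqDist
  split_ifs with hxy
  · positivity
  · exact pow_le_pow_of_le_one h0.le h1.le
      ((PiNat.mem_cylinder_iff_le_firstDiff hxy n).1 (PiNat.mem_cylinder_iff.2 h))

theorem seqDist_nonneg {lam : ℝ} (h0 : 0 < lam) (x y : ℕ → Fin r) : 0 ≤ seqDist lam x y := by
  unfold seqDist
  split_ifs <;> positivity

/-- A Hölder function oscillates by at most a geometric bound on pairs of cylinders. -/
theorem IsHolder.exists_abs_sub_le {lam θ : ℝ} (h0 : 0 < lam) (h1 : lam < 1) (hθ : 0 < θ)
    {A : hatSpace M → ℝ} (hA : IsHolder lam θ A) :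
    ∃ C, 0 ≤ C ∧ ∀ (n : ℕ) (p q : hatSpace M), (∀ i < n, p.1.1.1 i = q.1.1.1 i) →
      (∀ i < n, p.1.2.1 i = q.1.2.1 i) → |A p - A q| ≤ C * (lam ^ θ) ^ n := by
  obtain ⟨C, hC⟩ := hA
  refine ⟨|C|, abs_nonneg _, fun n p q h h' => (hC p q).trans ?_⟩
  have hd0 : 0 ≤ hatDist lam p q := le_max_of_le_left (seqDist_nonneg h0 _ _)
  have hd : hatDist lam p q ≤ lam ^ n :=
    max_le (seqDist_le_pow h0 h1 h) (seqDist_le_pow h0 h1 h')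
  have e : (lam ^ θ) ^ n = (lam ^ n) ^ θ := by
    rw [← Real.rpow_mul_natCast h0.le, mul_comm, Real.rpow_natCast_mul h0.le]
  rw [e]
  exact mul_le_mul (le_abs_self C) (Real.rpow_le_rpow hd0 hd hθ.le) (by positivity)
    (abs_nonneg C)

theorem continuous_coord (i : ℕ) : Continuous fun x : shiftSpace M => x.1 i :=
  (continuous_apply i).comp continuous_subtype_val

theorem IsHolder.continuous {lam θ : ℝ} (h0 : 0 < lam) (h1 : lam < 1) (hθ : 0 < θ)
    {A : hatSpace M → ℝ} (hA : IsHolder lam θ A) : Continuous A := by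
  obtain ⟨C, -, hC⟩ := hA.exists_abs_sub_le h0 h1 hθ
  refine continuous_iff_continuousAt.2 fun p => Metric.tendsto_nhds.2 fun ε hε => ?_
  have hlim : Tendsto (fun n : ℕ => C * (lam ^ θ) ^ n) atTop (𝓝 (C * 0)) :=
    (tendsto_pow_atTop_nhds_zero_of_lt_one (by positivity)
      (Real.rpow_lt_one h0.le h1 hθ)).const_mul C
  rw [mul_zero] at hlim
  obtain ⟨n, hn⟩ := (hlim.eventually (gt_mem_nhds hε)).exists
  have c1 : Continuous fun q : hatSpace M => q.1.1.1 :=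
    continuous_subtype_val.comp (continuous_fst.comp continuous_subtype_val)
  have c2 : Continuous fun q : hatSpace M => q.1.2.1 :=
    continuous_subtype_val.comp (continuous_snd.comp continuous_subtype_val)
  have o1 := ((PiNat.isOpen_cylinder (fun _ => Fin r) p.1.1.1 n).preimage c1).mem_nhds
    (x := p) (PiNat.self_mem_cylinder _ _)
  have o2 := ((PiNat.isOpen_cylinder (fun _ => Fin r) p.1.2.1 n).preimage c2).mem_nhds
    (x := p) (PiNat.self_mem_cylinder _ _)
  filter_upwards [o1, o2] with q hq1 hq2
  rw [Real.dist_eq]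
  exact (hC n q p (PiNat.mem_cylinder_iff.1 hq1) (PiNat.mem_cylinder_iff.1 hq2)).trans_lt hn

theorem compactSpace_shiftSpace (M : Matrix (Fin r) (Fin r) ℕ) : CompactSpace (shiftSpace M) := by
  refine isCompact_iff_compactSpace.1 (IsClosed.isCompact ?_)
  have : shiftSpace M = ⋂ j, {x | M (x j) (x (j + 1)) = 1} := by
    ext
    simp [shiftSpace]
  rw [this]
  refine isClosed_iInter fun j => ?_
  exact isClosed_discrete {q : Fin r × Fin r | M q.1 q.2 = 1} |>.preimage
    (f := fun x : ℕ → Fin r => (x j, x (j + 1)))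
    ((continuous_apply j).prodMk (continuous_apply (j + 1)))

theorem compactSpace_hatSpace (M : Matrix (Fin r) (Fin r) ℕ) : CompactSpace (hatSpace M) := by
  have := compactSpace_shiftSpace M
  have := compactSpace_shiftSpace M.transpose
  refine isCompact_iff_compactSpace.1 (IsClosed.isCompact ?_)
  exact isClosed_discrete {q : Fin r × Fin r | M q.1 q.2 = 1} |>.preimage
    (f := fun p : shiftSpace M.transpose × shiftSpace M => (p.1.1 0, p.2.1 0))
    (((continuous_coord 0).comp continuous_fst).prodMk ((continuous_coord 0).comp continuous_snd))

theorem continuous_shift : Continuous (shift (M := M)) :=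
  Continuous.subtype_mk (continuous_pi fun j => continuous_coord (j + 1)) _

theorem continuous_proj : Continuous (proj (M := M)) :=
  continuous_snd.comp continuous_subtype_val

theorem continuous_tau : Continuous (tau (M := M)) := by
  refine Continuous.subtype_mk (continuous_pi fun j => ?_) _
  cases j with
  | zero => exact (continuous_coord 0).comp (continuous_fst.comp continuous_subtype_val)
  | succ i => exact (continuous_coord i).comp (continuous_snd.comp continuous_subtype_val)

theorem shift_tau (p : hatSpace M) : shift (tau p) = proj p := rfl

theorem shift_iterate_apply (k : ℕ) (x : shiftSpace M) (i : ℕ) :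
    (shift^[k] x).1 i = x.1 (i + k) := by
  induction k generalizing x with
  | zero => rfl
  | succ k ih =>
    rw [Function.iterate_succ_apply, ih]
    exact congrArg x.1 (by ring)

/-! ### Extension of sequences to the past. -/

/-- Prepending a symbol to a sequence. -/
def cons (a : Fin r) (x : shiftSpace M) (h : M a (x.1 0) = 1) : shiftSpace M :=
  ⟨fun j => Nat.casesOn j a (fun i => x.1 i), fun j => by
    cases j with
    | zero => exact h
    | succ i => exact x.2 i⟩

/-- If another first symbol occurs, transitivity leads from it to `x₀` in at least one step, and the
symbol just before arrival is a predecessor. Otherwise every point starts with `x₀`, so `x₁ = x₀`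
and `x₀` precedes itself. -/
theorem IsTransitive.shift_surjective (hM : IsTransitive M) :
    Function.Surjective (shift (M := M)) := by
  intro x
  suffices h : ∃ a, M a (x.1 0) = 1 by
    obtain ⟨a, ha⟩ := h
    exact ⟨cons a x ha, rfl⟩
  by_cases hU : ∃ u : shiftSpace M, u.1 0 ≠ x.1 0
  · obtain ⟨k, v, ⟨u, hu, rfl⟩, hv⟩ := hM {v | v.1 0 ≠ x.1 0} {v | v.1 0 = x.1 0}
      ((isOpen_discrete {a | a ≠ x.1 0}).preimage (continuous_coord 0))
      ((isOpen_discrete {a | a = x.1 0}).preimage (continuous_coord 0)) hU ⟨x, rfl⟩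
    rw [Set.mem_ofPred_eq, shift_iterate_apply] at hv
    cases k with
    | zero => exact absurd hv hu
    | succ k =>
      refine ⟨u.1 k, ?_⟩
      rw [← hv, zero_add]
      exact u.2 k
  · push Not at hU
    refine ⟨x.1 0, ?_⟩
    have h := x.2 0
    rwa [show x.1 (0 + 1) = x.1 0 from hU (shift x)] at h

/-- Under transitivity every sequence can be extended to the past. -/
theorem IsTransitive.exists_past (hM : IsTransitive M) (x : shiftSpace M) :
    ∃ y : shiftSpace M.transpose, y.1 0 = x.1 0 := by
  obtain ⟨g, hg⟩ := hM.shift_surjective.hasRightInverse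
  refine ⟨⟨fun j => (g^[j] x).1 0, fun j => ?_⟩, rfl⟩
  change M ((g^[j + 1] x).1 0) ((g^[j] x).1 0) = 1
  rw [Function.iterate_succ_apply']
  have h : (g (g^[j] x)).1 1 = (g^[j] x).1 0 := congrArg (fun u => u.1 0) (hg (g^[j] x))
  rw [← h]
  exact (g (g^[j] x)).2 0

/-- Letting the past depend on `x₀` alone makes the choice locally constant, hence continuous. -/
theorem IsTransitive.exists_past_section (hM : IsTransitive M) [Nonempty (shiftSpace M)] :
    ∃ b : Fin r → shiftSpace M.transpose, ∀ x : shiftSpace M, (b (x.1 0)).1 0 = x.1 0 := by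
  classical
  obtain ⟨y₀, -⟩ := hM.exists_past (Classical.arbitrary _)
  refine ⟨fun a => if h : ∃ y : shiftSpace M.transpose, y.1 0 = a then h.choose else y₀,
    fun x => ?_⟩
  simp only [dif_pos (hM.exists_past x)]
  exact (hM.exists_past x).choose_spec

/-! ### The fibrewise maximum and its integral. -/

/-- A parametrization of the fibre of `tau` over `x` by all of the dual subshift: a past `y` which
does not begin with `x₀` is replaced by the past `b x₀`. -/
def glue {b : Fin r → shiftSpace M.transpose} (hb : ∀ x : shiftSpace M, (b (x.1 0)).1 0 = x.1 0)
    (y : shiftSpace M.transpose) (x : shiftSpace M) : hatSpace M :=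
  ⟨(if y.1 0 = x.1 0 then y else b (x.1 0), shift x), by
    have h : (if y.1 0 = x.1 0 then y else b (x.1 0)).1 0 = x.1 0 := by
      split_ifs with h
      exacts [h, hb x]
    change M ((if y.1 0 = x.1 0 then y else b (x.1 0)).1 0) (x.1 1) = 1
    rw [h]
    exact x.2 0⟩

section glue

variable {b : Fin r → shiftSpace M.transpose} (hb : ∀ x : shiftSpace M, (b (x.1 0)).1 0 = x.1 0)

theorem tau_glue (y : shiftSpace M.transpose) (x : shiftSpace M) : tau (glue hb y x) = x := by
  ext j : 2
  cases j with
  | zero =>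
    change (if y.1 0 = x.1 0 then y else b (x.1 0)).1 0 = x.1 0
    split_ifs with h
    exacts [h, hb x]
  | succ i => rfl

theorem glue_tau (p : hatSpace M) : glue hb p.1.1 (tau p) = p :=
  Subtype.ext (Prod.ext (if_pos rfl) rfl)

/-- The two cases are separated by a clopen condition. Joint continuity over a fixed compact
parameter space is what makes the fibrewise maximum continuous. -/
theorem continuous_glue :
    Continuous fun q : shiftSpace M × shiftSpace M.transpose => glue hb q.2 q.1 := by
  refine Continuous.subtype_mk (Continuous.prodMk (Continuous.if ?_ continuous_snd ?_)
    (continuous_shift.comp continuous_fst)) _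
  · intro q hq
    have hcl : IsClopen {q : shiftSpace M × shiftSpace M.transpose | q.2.1 0 = q.1.1 0} :=
      (isClopen_discrete {q : Fin r × Fin r | q.2 = q.1}).preimage
        (((continuous_coord 0).comp continuous_fst).prodMk
          ((continuous_coord 0).comp continuous_snd))
    rw [hcl.frontier_eq] at hq
    exact hq.elim
  · exact continuous_of_discreteTopology.comp ((continuous_coord 0).comp continuous_fst)

end glue

/-- The fibrewise maximum of a continuous function along `tau`: it is continuous and attained, and
almost attained along measurable sections of `tau`. -/
theorem IsTransitive.exists_fiberMax (hM : IsTransitive M) [Nonempty (shiftSpace M)]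
    {A : hatSpace M → ℝ} (hA : Continuous A) :
    ∃ F : shiftSpace M → ℝ, Continuous F ∧ (∀ p, A p ≤ F (tau p)) ∧
      (∀ x, ∃ p, tau p = x ∧ A p = F x) ∧
      ∀ ε > 0, ∃ s : shiftSpace M → hatSpace M, Measurable s ∧
        ∀ x, tau (s x) = x ∧ F x - ε < A (s x) := by
  obtain ⟨b, hb⟩ := hM.exists_past_section
  have := compactSpace_shiftSpace M.transpose
  have : Nonempty (shiftSpace M.transpose) := ⟨b ((Classical.arbitrary (shiftSpace M)).1 0)⟩
  have hG := continuous_glue hb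
  have hcont : ∀ x, Continuous fun y => A (glue hb y x) := fun x =>
    hA.comp (hG.comp (Continuous.prodMk_right x))
  set F : shiftSpace M → ℝ := fun x => sSup ((fun y => A (glue hb y x)) '' Set.univ) with hF
  have hFc : Continuous F :=
    isCompact_univ.continuous_sSup (f := fun x y => A (glue hb y x)) (hA.comp hG)
  have hle : ∀ x y, A (glue hb y x) ≤ F x := fun x y =>
    le_csSup (isCompact_univ.image (hcont x)).bddAbove ⟨y, trivial, rfl⟩
  have hmax : ∀ x, ∃ y, A (glue hb y x) = F x := fun x => by
    obtain ⟨y, -, hy⟩ := (isCompact_univ.image (hcont x)).sSup_mem (Set.univ_nonempty.image _)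
    exact ⟨y, hy⟩
  refine ⟨F, hFc, fun p => ?_, fun x => ?_, fun ε hε => ?_⟩
  · simpa only [glue_tau] using hle (tau p) p.1.1
  · obtain ⟨y, hy⟩ := hmax x
    exact ⟨_, tau_glue hb y x, hy⟩
  · classical
    -- Near-maximality is an open condition on `y`, so some term of a dense sequence satisfies it;
    -- the least such index depends measurably on `x`.
    set d := TopologicalSpace.denseSeq (shiftSpace M.transpose) with hd
    have hex : ∀ x, ∃ n, F x - ε < A (glue hb (d n) x) := fun x => by
      obtain ⟨y, hy⟩ := hmax x
      have ho : IsOpen {y | F x - ε < A (glue hb y x)} := isOpen_lt continuous_const (hcont x)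
      obtain ⟨_, h, n, rfl⟩ :=
        (TopologicalSpace.denseRange_denseSeq (shiftSpace M.transpose)).inter_open_nonempty _ ho
          ⟨y, by rw [Set.mem_ofPred_eq, hy]; linarith⟩
      exact ⟨n, h⟩
    refine ⟨fun x => glue hb (d (Nat.find (hex x))) x, ?_, fun x =>
      ⟨tau_glue hb _ x, Nat.find_spec (hex x)⟩⟩
    have hn : Measurable fun x => Nat.find (hex x) := measurable_find hex fun n =>
      (isOpen_lt (hFc.sub continuous_const)
        (hA.comp (hG.comp (Continuous.prodMk_left (d n))))).measurableSet
    exact hG.measurable.comp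
      (measurable_id.prodMk ((measurable_of_countable d).comp hn))

/-- The set of integrals defining `beta` is bounded above. -/
theorem bddAbove_integral_holonomic {A : hatSpace M → ℝ} {K : ℝ} (hK : ∀ p, A p ≤ K)
    (hK0 : 0 ≤ K) :
    BddAbove ((fun μ : Measure (hatSpace M) => ∫ p, A p ∂μ) '' holonomic M) := by
  refine ⟨K, ?_⟩
  rintro _ ⟨μ, ⟨hμ, -⟩, rfl⟩
  by_cases hi : Integrable A μ
  · calc ∫ p, A p ∂μ ≤ ∫ _, K ∂μ := integral_mono hi (integrable_const K) hK
      _ = K := by simp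
  -- A non-integrable `A` has integral `0` by convention, whence the need for `0 ≤ K`.
  · simpa [integral_undef hi] using hK0

/-- The fibrewise maximum has integral `beta A` for the projection of a maximizing measure. -/
theorem integral_fiberMax_eq_beta {A : hatSpace M → ℝ} (hA : Continuous A)
    {μ : Measure (hatSpace M)} (hμ : μ ∈ maximizing A)
    (hinv : MeasurePreserving shift (μ.map proj) (μ.map proj)) {F : shiftSpace M → ℝ}
    (hF : Continuous F) (hAF : ∀ p, A p ≤ F (tau p))
    (hsec : ∀ ε > 0, ∃ s : shiftSpace M → hatSpace M, Measurable s ∧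
        ∀ x, tau (s x) = x ∧ F x - ε < A (s x)) :
    ∫ x, F x ∂(μ.map proj) = beta A := by
  have := compactSpace_shiftSpace M
  have := compactSpace_hatSpace M
  obtain ⟨⟨hprob, hhol⟩, hβ⟩ := hμ
  have hpm : Measurable (proj (M := M)) := continuous_proj.measurable
  have : IsProbabilityMeasure (μ.map proj) := Measure.isProbabilityMeasure_map hpm.aemeasurable
  obtain ⟨K, hK⟩ := isCompact_univ.exists_bound_of_continuousOn (f := A) hA.continuousOn
  obtain ⟨p₀⟩ : Nonempty (hatSpace M) := μ.nonempty_of_neZero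
  have hbdd := bddAbove_integral_holonomic (A := A) (K := K)
    (fun p => (le_abs_self _).trans (hK p trivial)) ((abs_nonneg _).trans (hK p₀ trivial))
  have hFi : Integrable F (μ.map proj) :=
    hF.integrable_of_hasCompactSupport (HasCompactSupport.of_compactSpace F)
  apply le_antisymm
  · refine le_of_forall_pos_le_add fun ε hε => ?_
    obtain ⟨s, hs, hsx⟩ := hsec ε hε
    have hprojs : ∀ x, proj (s x) = shift x := fun x => by rw [← shift_tau, (hsx x).1]
    have hs_prob : IsProbabilityMeasure ((μ.map proj).map s) :=
      Measure.isProbabilityMeasure_map hs.aemeasurable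
    -- As `tau ∘ s = id` and `proj ∘ s = shift`, holonomy of the image measure is shift invariance
    -- of the projection.
    have hmem : (μ.map proj).map s ∈ holonomic M := by
      refine ⟨hs_prob, fun f => ?_⟩
      rw [integral_map (f := fun p => f (tau p)) hs.aemeasurable
          (f.continuous.comp continuous_tau).aestronglyMeasurable,
        integral_map (f := fun p => f (proj p)) hs.aemeasurable
          (f.continuous.comp continuous_proj).aestronglyMeasurable]
      simp only [(hsx _).1, hprojs]
      conv_lhs => rw [← hinv.map_eq]
      rw [integral_map hinv.measurable.aemeasurable f.continuous.aestronglyMeasurable]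
    have hle : ∫ p, A p ∂((μ.map proj).map s) ≤ beta A := le_csSup hbdd ⟨_, hmem, rfl⟩
    have hAs : Integrable (fun x => A (s x)) (μ.map proj) :=
      (hA.integrable_of_hasCompactSupport (μ := (μ.map proj).map s)
        (HasCompactSupport.of_compactSpace A)).comp_measurable hs
    rw [integral_map hs.aemeasurable hA.aestronglyMeasurable] at hle
    have h := integral_mono (hFi.sub (integrable_const ε)) hAs fun x => (hsx x).2.le
    simp only [Pi.sub_apply] at h
    rw [integral_sub hFi (integrable_const ε)] at h
    simp only [integral_const, probReal_univ, one_smul] at h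
    linarith
  · have hF' := hhol ⟨F, hF⟩
    simp only [ContinuousMap.coe_mk] at hF'
    rw [integral_map hpm.aemeasurable hF.aestronglyMeasurable, ← hβ, ← hF']
    exact integral_mono (hA.integrable_of_hasCompactSupport (HasCompactSupport.of_compactSpace A))
      ((hF.comp continuous_tau).integrable_of_hasCompactSupport
        (HasCompactSupport.of_compactSpace _)) hAF

end Holonomic

/-! ### Closing orbit segments into paths. -/

namespace Holonomic

variable {r : ℕ} {M : Matrix (Fin r) (Fin r) ℕ}

/-- The sequence formed by the first `k` symbols of `z` followed by `x`. -/
def splice (z : shiftSpace M) (k : ℕ) (x : shiftSpace M) (h : z.1 k = x.1 0) : shiftSpace M :=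
  ⟨fun i => if i < k then z.1 i else x.1 (i - k), fun i => by
    rcases lt_trichotomy (i + 1) k with hi | hi | hi
    · simpa [hi, (Nat.lt_succ_self i).trans hi] using z.2 i
    · subst hi
      have := z.2 i
      rw [h] at this
      simpa using this
    · have h1 : ¬ i < k := by omega
      have h2 : ¬ i + 1 < k := by omega
      have h3 : i + 1 - k = i - k + 1 := by omega
      simpa [h1, h2, h3] using x.2 (i - k)⟩

theorem splice_eq_of_lt {z x : shiftSpace M} {k m : ℕ} (h : z.1 k = x.1 0)
    (hz : ∀ i < m, z.1 (i + k) = x.1 i) {i : ℕ} (hi : i < m + k) :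
    (splice z k x h).1 i = z.1 i := by
  change (if i < k then z.1 i else x.1 (i - k)) = z.1 i
  split_ifs with hik
  · rfl
  · rw [← hz (i - k) (by omega)]
    exact congrArg z.1 (by omega)

theorem shift_iterate_splice {z x : shiftSpace M} {k : ℕ} (h : z.1 k = x.1 0) :
    shift^[k] (splice z k x h) = x := by
  ext i : 2
  rw [shift_iterate_apply]
  change (if i + k < k then z.1 (i + k) else x.1 (i + k - k)) = x.1 i
  simp

/-- A near-return of the shift orbit of `z` close to `x` yields a closed path based at `x` along
which the sum of `A` is close to the Birkhoff sum of the fibrewise maximum `F`. -/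
theorem exists_path_of_near_return {lam ε : ℝ} (h0 : 0 < lam) (h1 : lam < 1)
    {A : hatSpace M → ℝ} {F : shiftSpace M → ℝ} (hatt : ∀ x, ∃ p, tau p = x ∧ A p = F x)
    {C ρ : ℝ} (hosc : ∀ (n : ℕ) (p q : hatSpace M), (∀ i < n, p.1.1.1 i = q.1.1.1 i) →
      (∀ i < n, p.1.2.1 i = q.1.2.1 i) → |A p - A q| ≤ C * ρ ^ n)
    {x z : shiftSpace M} {n m : ℕ} (hm : 0 < m) (hmε : lam ^ m < ε)
    (hz : ∀ i < m, z.1 i = x.1 i) (hz' : ∀ i < m, (shift^[n + 1] z).1 i = x.1 i) (β : ℝ) :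
    ∃ p ∈ paths lam x x ε n,
      |∑ j, (A (p j) - β) - birkhoffSum shift (fun u => F u - β) (n + 1) z| ≤
        ∑ j ∈ Finset.range (n + 1), C * ρ ^ (m + j) := by
  choose q hq hqA using hatt
  have hret : ∀ i < m, z.1 (i + (n + 1)) = x.1 i := fun i hi => by
    rw [← shift_iterate_apply]
    exact hz' i hi
  have hzx : z.1 (n + 1) = x.1 0 := by simpa using hret 0 hm
  set w := splice z (n + 1) x hzx with hw
  have hwz : ∀ i < m + (n + 1), w.1 i = z.1 i := fun i hi => splice_eq_of_lt hzx hret hi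
  have hq0 : ∀ u : shiftSpace M, (q u).1.1.1 0 = u.1 0 := fun u =>
    congrArg (fun v => v.1 0) (hq u)
  have hstart : ∀ j ≤ n, (q (shift^[j] z)).1.1.1 0 = w.1 j := fun j hj => by
    rw [hq0, shift_iterate_apply, hwz j (by omega), zero_add]
  -- The orbit of `w` run backwards, from `shift^[n + 1] w = x` to `w`; the pasts are optimal for
  -- the orbit of `z`, and fit because their first symbols agree with `w`.
  let P : Fin (n + 1) → hatSpace M := fun j =>
    ⟨((q (shift^[n - j] z)).1.1, shift^[n - j + 1] w), by
      change M ((q (shift^[n - j] z)).1.1.1 0) ((shift^[n - j + 1] w).1 0) = 1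
      rw [hstart _ (by omega), shift_iterate_apply, zero_add]
      exact w.2 (n - j)⟩
  have hPtau : ∀ j, tau (P j) = shift^[n - j] w := fun j => by
    ext i : 2
    cases i with
    | zero =>
      rw [shift_iterate_apply, zero_add]
      exact hstart _ (by omega)
    | succ i =>
      change (shift^[n - j + 1] w).1 i = _
      rw [shift_iterate_apply, shift_iterate_apply]
      exact congrArg w.1 (by omega)
  refine ⟨P, ⟨?_, fun j => ?_, ?_⟩, ?_⟩
  · exact shift_iterate_splice hzx
  · rw [hPtau]
    change shift^[n - (j + 1 : ℕ) + 1] w = shift^[n - j] w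
    congr 1
    omega
  · rw [hPtau, Fin.val_last, Nat.sub_self]
    refine (seqDist_le_pow h0 h1 fun i hi => ?_).trans_lt hmε
    exact (hwz i (by omega)).trans (hz i hi)
  · have e : birkhoffSum shift (fun u => F u - β) (n + 1) z
        = ∑ j : Fin (n + 1), (F (shift^[n - j] z) - β) := by
      rw [Fin.sum_univ_eq_sum_range (fun j => F (shift^[n - j] z) - β), birkhoffSum,
        ← Finset.sum_range_reflect]
      rfl
    rw [e, ← Finset.sum_sub_distrib, ← Fin.sum_univ_eq_sum_range (fun j => C * ρ ^ (m + j))]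
    refine (Finset.abs_sum_le_sum_abs _ _).trans (Finset.sum_le_sum fun j _ => ?_)
    rw [sub_sub_sub_cancel_right, ← hqA]
    -- The pasts coincide. As `w` and `z` share `m + (n + 1)` symbols, their shifts by `n - j + 1`
    -- share `m + j`.
    refine hosc _ _ _ (fun _ _ => rfl) fun i hi => ?_
    have e2 : (q (shift^[n - j] z)).1.2 = shift (shift^[n - j] z) := by
      change proj _ = _
      rw [← shift_tau, hq]
    rw [e2, ← Function.iterate_succ_apply' shift]
    change (shift^[n - j + 1] w).1 i = _
    rw [shift_iterate_apply, shift_iterate_apply]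
    exact hwz _ (by omega)

end Holonomic

/-! ### The main theorem. -/

open Holonomic in
theorem mainTheorem8 {r : ℕ} (M : Matrix (Fin r) (Fin r) ℕ) (hM : Holonomic.IsTransitive M)
    (lam : ℝ) (hlam0 : 0 < lam) (hlam1 : lam < 1) (θ : ℝ) (hθ : 0 < θ)
    (A : Holonomic.hatSpace M → ℝ) (hA : Holonomic.IsHolder lam θ A)
    (μ : Measure (Holonomic.hatSpace M)) (hμ : μ ∈ Holonomic.maximizing A)
    (herg : Ergodic (Holonomic.shift (M := M)) (μ.map Holonomic.proj)) :
    Holonomic.proj '' μ.support ⊆ Holonomic.nonwandering lam A := by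
  rintro _ ⟨p₀, hp₀, rfl⟩ ε hε
  set x := proj p₀ with hx
  have hAc := hA.continuous hlam0 hlam1 hθ
  obtain ⟨C, hC0, hC⟩ := hA.exists_abs_sub_le hlam0 hlam1 hθ
  set ρ := lam ^ θ with hρ
  have hρ0 : 0 < ρ := Real.rpow_pos_of_pos hlam0 θ
  have hρ1 : ρ < 1 := Real.rpow_lt_one hlam0.le hlam1 hθ
  have : Nonempty (shiftSpace M) := ⟨x⟩
  have := compactSpace_shiftSpace M
  have : IsProbabilityMeasure μ := hμ.1.1
  have hpm : Measurable (proj (M := M)) := continuous_proj.measurable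
  have : IsProbabilityMeasure (μ.map proj) := Measure.isProbabilityMeasure_map hpm.aemeasurable
  obtain ⟨F, hF, hAF, hatt, hsec⟩ := hM.exists_fiberMax hAc
  have hint := integral_fiberMax_eq_beta hAc hμ herg.toMeasurePreserving hF hAF hsec
  obtain ⟨K, hK⟩ := isCompact_univ.exists_bound_of_continuousOn (f := fun u => F u - beta A)
    (hF.sub continuous_const).continuousOn
  have hg2 : MemLp (fun u => F u - beta A) 2 (μ.map proj) :=
    MemLp.of_bound (hF.sub continuous_const).aestronglyMeasurable K
      (Eventually.of_forall fun u => hK u trivial)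
  have hFi : Integrable F (μ.map proj) :=
    hF.integrable_of_hasCompactSupport (HasCompactSupport.of_compactSpace F)
  have hg0 : ∫ u, (F u - beta A) ∂(μ.map proj) = 0 := by
    rw [integral_sub hFi (integrable_const _), hint]
    simp
  have hlim : Tendsto (fun m : ℕ => C * (1 - ρ)⁻¹ * ρ ^ m) atTop (𝓝 (C * (1 - ρ)⁻¹ * 0)) :=
    (tendsto_pow_atTop_nhds_zero_of_lt_one hρ0.le hρ1).const_mul _
  rw [mul_zero] at hlim
  -- The depth `m` puts the cylinder within `ε` of `x` and the total Hölder error below `ε / 2`; the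
  -- other half is left for the Birkhoff sum.
  obtain ⟨m, hm, hmε, hmC⟩ := ((eventually_gt_atTop 0).and
    (((tendsto_pow_atTop_nhds_zero_of_lt_one hlam0.le hlam1).eventually (gt_mem_nhds hε)).and
      (hlim.eventually (gt_mem_nhds (half_pos hε))))).exists
  set B : Set (shiftSpace M) := Subtype.val ⁻¹' PiNat.cylinder x.1 m with hB
  have hBo : IsOpen B :=
    (PiNat.isOpen_cylinder (fun _ => Fin r) x.1 m).preimage continuous_subtype_val
  have hBpos : 0 < μ.map proj B := by
    rw [Measure.map_apply hpm hBo.measurableSet]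
    exact Measure.mem_support_iff_forall _ |>.1 hp₀ _
      ((hBo.preimage continuous_proj).mem_nhds (PiNat.self_mem_cylinder x.1 m))
  obtain ⟨z, hzB, n, hzn, hsum⟩ := herg.exists_recurrent_abs_birkhoffSum_lt hg2 hg0
    hBo.measurableSet hBpos (half_pos hε)
  obtain ⟨p, hp, hpsum⟩ := exists_path_of_near_return hlam0 hlam1 hatt hC hm hmε
    (PiNat.mem_cylinder_iff.1 hzB) (PiNat.mem_cylinder_iff.1 hzn) (beta A)
  refine ⟨n, p, hp, ?_⟩
  have hgeom : ∑ j ∈ Finset.range (n + 1), C * ρ ^ (m + j) ≤ C * (1 - ρ)⁻¹ * ρ ^ m := by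
    have h := (summable_geometric_of_lt_one hρ0.le hρ1).sum_le_tsum (Finset.range (n + 1))
      fun j _ => (pow_pos hρ0 j).le
    rw [tsum_geometric_of_lt_one hρ0.le hρ1] at h
    calc ∑ j ∈ Finset.range (n + 1), C * ρ ^ (m + j)
        = C * ρ ^ m * ∑ j ∈ Finset.range (n + 1), ρ ^ j := by
          rw [Finset.mul_sum]
          exact Finset.sum_congr rfl fun j _ => by ring
      _ ≤ C * ρ ^ m * (1 - ρ)⁻¹ := by gcongr
      _ = _ := by ring
  rw [abs_lt] at hsum ⊢
  have := abs_le.1 (hpsum.trans hgeom)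
  constructor <;> linarith
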